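/- Let $\mathcal D$ be a set. A plane rooted tree decorated by $\mathcal D$ is a finite rooted tree in which the children of every vertex are linearly ordered (from left to right) and every vertex carries an element of $\mathcal D$; let $\mathcal T$ be the set of these trees. A forest is a finite, possibly empty sequence $F=t_1\cdots t_n$ of such trees; let $\mathcal F$ be the set of forests, and let the weight of a forest be its number of vertices. Let $\mathcal H=\mathcal H^{\mathcal D}_{P,R}$ be the free associative unital $\mathbb Q$-algebra on $\mathcal T$; the forests are its monomials, hence a $\mathbb Q$-basis, with the empty forest equal to $1$, and $\mathcal H$ is graded by the weight. An admissible cut $c$ of a tree $t$ is either the total cut, with $P^c(t)=t$ and $R^c(t)=1$, or a (possibly empty) set of edges of $t$ such that every path going upwards from the root contains at most one of them; in the latter case $R^c(t)$ is the component of the root after the edges of $c$ are removed and $P^c(t)$ is the forest of the other components, from left to right. An admissible cut of a forest $F=t_1\cdots t_n$ is a tuple $c=(c_1,\dots,c_n)$ of admissible cuts $c_i$ of $t_i$, with $P^c(F)=P^{c_1}(t_1)\cdots P^{c_n}(t_n)$ and $R^c(F)=R^{c_1}(t_1)\cdots R^{c_n}(t_n)$. With the coproduct $\Delta(F)=\sum_c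 P^c(F)\otimes R^c(F)$, the sum being over all admissible cuts of $F$, and the counit $\varepsilon(1)=1$, $\varepsilon(F)=0$ for $F\neq1$, the algebra $\mathcal H$ is a graded Hopf algebra; let $S$ be its antipode and $\mathrm{Prim}(\mathcal H)=\{x:\Delta(x)=x\otimes1+1\otimes x\}$. For $d\in\mathcal D$ let $B_d^+$ be the linear endomorphism of $\mathcal H$ that sends a forest $t_1\cdots t_n$ to the tree obtained by grafting $t_1,\dots,t_n$, in this order, on a common root decorated by $d$, and let $\gamma_d$ be the linear endomorphism of $\mathcal H$ that sends $t_1\cdots t_n$ to $t_1\cdots t_{n-1}$ if $n\ge1$ and $t_n$ is the one-vertex tree decorated by $d$, and sends every other forest (including $1$) to $0$. Then there is a unique bilinear form $(\ ,\ )$ on $\mathcal H$ such that 1. $(1,x)=\varepsilon(x)$ for all $x\in\mathcal H$; 2. $(x_1x_2,y)=(x_1\otimes x_2,\Delta(y))$ for all $x_1,x_2,y\in\mathcal H$, where $(x_1\otimes x_2,y_1\otimes y_2)=(x_1,y_1)(x_2,y_2)$; 3. $(B_d^+(x),y)=(x,\gamma_d(y))$ for all $x,y\in\mathcal H$ and $d\in\mathcal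 D$. Moreover, this form satisfies: 4. $(x,y)=0$ if $x$ and $y$ are homogeneous of different weights; 5. $(\ ,\ )$ is symmetric and non-degenerate; 6. $(S(x),y)=(x,S(y))$ for all $x,y\in\mathcal H$; 7. there is a unique family $(e_F)_{F\in\mathcal F}$ in $\mathcal H$ with $(e_F,G)=\delta_{F,G}$ for all $F,G\in\mathcal F$, it is a basis of $\mathcal H$, and - a) $e_F$ is homogeneous of weight equal to the weight of $F$; - b) $(e_t)_{t\in\mathcal T}$ is a basis of $\mathrm{Prim}(\mathcal H)$; - c) for every forest $t_1\cdots t_n$, $\displaystyle\Delta(e_{t_1\cdots t_n})=\sum_{i=0}^n e_{t_1\cdots t_i}\otimes e_{t_{i+1}\cdots t_n}$. -/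

import Mathlib

open scoped TensorProduct

/-- Plane rooted trees whose vertices are decorated by `D`: a decorated root together with the
ordered list of the subtrees attached to it. -/
inductive PTree (D : Type*) : Type _
  | node : D → List (PTree D) → PTree D

/-- Plane rooted forests: finite sequences of plane rooted trees. -/
abbrev PForest (D : Type*) : Type _ := List (PTree D)

namespace PTree

variable {D : Type*}

theorem ind {p : PTree D → Prop} (h : ∀ d F, (∀ t ∈ F, p t) → p (node d F)) : ∀ t, p t
  | node d F => h d F (fun t _ => ind h t)

mutual
/-- The weight of a tree: its number of vertices. -/
def weight : PTree D → ℕ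
  | node _ F => forestWeight F + 1
/-- The weight of a forest: its number of vertices. -/
def forestWeight : List (PTree D) → ℕ
  | [] => 0
  | t :: F => weight t + forestWeight F
end

mutual
/-- All the markings of a tree by subsets of its vertex set (`true` means marked), each listed
once. Marking a vertex other than the root stands for cutting the edge that arrives at it, and
marking the root stands for cutting below the root, as the total cut does. -/
def markings : PTree D → List (PTree (D × Bool))
  | node d F =>
      (forestMarkings F).map (node (d, true)) ++ (forestMarkings F).map (node (d, false))
/-- All the markings of a forest by subsets of its vertex set, each listed once. -/
def forestMarkings : List (PTree D) → List (List (PTree (D × Bool)))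
  | [] => [[]]
  | t :: F => (markings t).flatMap fun t' => (forestMarkings F).map fun F' => t' :: F'
end

mutual
/-- The largest number of marked vertices on a path going up from the root. -/
def pathMarks : PTree (D × Bool) → ℕ
  | node (_, b) F => b.toNat + forestPathMarks F
/-- The largest number of marked vertices on a path going up from one of the roots. -/
def forestPathMarks : List (PTree (D × Bool)) → ℕ
  | [] => 0
  | t :: F => max (pathMarks t) (forestPathMarks F)
end

mutual
/-- Forget the marks. -/
def unmark : PTree (D × Bool) → PTree D
  | node (d, _) F => node d (forestUnmark F)
/-- Forget the marks. -/
def forestUnmark : List (PTree (D × Bool)) → List (PTree D)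
  | [] => []
  | t :: F => unmark t :: forestUnmark F
end

mutual
/-- The part `P^c(t)` of a cut tree: the plane forest of the components cut off, from left to
right. (It is used for admissible cuts only, where nothing above a marked vertex is marked.) -/
def pruned : PTree (D × Bool) → List (PTree D)
  | node (d, true) F => [unmark (node (d, true) F)]
  | node (_, false) F => forestPruned F
/-- The part `P^c(F)` of a cut forest. -/
def forestPruned : List (PTree (D × Bool)) → List (PTree D)
  | [] => []
  | t :: F => pruned t ++ forestPruned F
end

mutual
/-- The part `R^c(t)` of a cut tree: the component of the root, or the empty forest if the cut is
total. -/
def trunk : PTree (D × Bool) → List (PTree D)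
  | node (_, true) _ => []
  | node (d, false) F => [node d (forestTrunk F)]
/-- The part `R^c(F)` of a cut forest. -/
def forestTrunk : List (PTree (D × Bool)) → List (PTree D)
  | [] => []
  | t :: F => trunk t ++ forestTrunk F
end

/-- The admissible cuts of a forest, the empty and the total cuts of its trees included: the
markings such that every path meets at most one mark. -/
def cuts (F : PForest D) : List (PForest (D × Bool)) :=
  (forestMarkings F).filter fun c => forestPathMarks c ≤ 1


theorem filter_flatMap_map {α : Type*} (p : α → Bool) (q : List α → Bool) (l : List α)
    (m : List (List α)) (r : List α → Bool) (h : ∀ a b, r (a :: b) = (p a && q b)) :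
    ((l.flatMap fun a => m.map fun b => a :: b).filter r) =
      (l.filter p).flatMap fun a => (m.filter q).map fun b => a :: b := by
  induction l with
  | nil => rfl
  | cons a l ih =>
    rw [List.flatMap_cons, List.filter_append, ih, List.filter_map]
    by_cases ha : p a
    · simp [Function.comp_def, h, ha]
    · simp [Function.comp_def, h, ha]

/-- The admissible cuts of a tree, the empty and the total cut included. -/
def treeCuts (t : PTree D) : List (PTree (D × Bool)) :=
  (markings t).filter fun c => pathMarks c ≤ 1

theorem cuts_nil : cuts ([] : PForest D) = [[]] := by
  simp [cuts, forestMarkings, forestPathMarks]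

theorem cuts_cons (t : PTree D) (F : PForest D) :
    cuts (t :: F) = (treeCuts t).flatMap fun a => (cuts F).map fun b => a :: b := by
  rw [cuts, forestMarkings]
  exact filter_flatMap_map _ _ _ _ _ (fun a b => by simp [forestPathMarks])

mutual
/-- Tree with no mark. -/
def plain : PTree D → PTree (D × Bool)
  | node d F => node (d, false) (forestPlain F)
/-- Forest with no mark. -/
def forestPlain : List (PTree D) → List (PTree (D × Bool))
  | [] => []
  | t :: F => plain t :: forestPlain F
end

mutual
theorem filter_markings_zero : ∀ t : PTree D,
    (markings t).filter (fun c => pathMarks c = 0) = [plain t]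
  | node d F => by
    have := filter_forestMarkings_zero F
    simp [markings, List.filter_map, Function.comp_def, pathMarks, plain, this]
theorem filter_forestMarkings_zero : ∀ F : List (PTree D),
    (forestMarkings F).filter (fun c => forestPathMarks c = 0) = [forestPlain F]
  | [] => by simp [forestMarkings, forestPathMarks, forestPlain]
  | t :: F => by
    rw [forestMarkings, filter_flatMap_map (fun c => pathMarks c = 0)
      (fun c => forestPathMarks c = 0) _ _ _ (fun a b => by simp [forestPathMarks]),
      filter_markings_zero t, filter_forestMarkings_zero F]
    simp [forestPlain]
end

mutual
theorem unmark_plain : ∀ t : PTree D, unmark (plain t) = t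
  | node d F => by simp [plain, unmark, forestUnmark_plain F]
theorem forestUnmark_plain : ∀ F : List (PTree D), forestUnmark (forestPlain F) = F
  | [] => rfl
  | t :: F => by simp [forestPlain, forestUnmark, unmark_plain t, forestUnmark_plain F]
end

theorem treeCuts_node (d : D) (F : PForest D) :
    treeCuts (node d F) = node (d, true) (forestPlain F) :: (cuts F).map (node (d, false)) := by
  have := filter_forestMarkings_zero F
  simp [treeCuts, markings, List.filter_map, Function.comp_def, pathMarks, this, cuts]

mutual
theorem weight_unmark : ∀ c : PTree (D × Bool), weight (unmark c) = weight c
  | node (d, b) F => by simp [unmark, weight, weight_forestUnmark F]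
theorem weight_forestUnmark : ∀ c : List (PTree (D × Bool)),
    forestWeight (forestUnmark c) = forestWeight c
  | [] => rfl
  | t :: F => by simp [forestUnmark, forestWeight, weight_unmark t, weight_forestUnmark F]
end

theorem forestWeight_append {E : Type*} (F G : PForest E) :
    forestWeight (F ++ G) = forestWeight F + forestWeight G := by
  induction F with
  | nil => simp [forestWeight]
  | cons t F ih => simp [forestWeight, ih, add_assoc]

mutual
theorem weight_pruned_trunk : ∀ c : PTree (D × Bool),
    forestWeight (pruned c) + forestWeight (trunk c) = weight c
  | node (d, true) F => by
    rw [pruned, trunk, forestWeight, forestWeight, weight_unmark]; rfl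
  | node (d, false) F => by
    have := weight_forestPruned_trunk F
    simp only [pruned, trunk, forestWeight, weight]; omega
theorem weight_forestPruned_trunk : ∀ c : List (PTree (D × Bool)),
    forestWeight (forestPruned c) + forestWeight (forestTrunk c) = forestWeight c
  | [] => rfl
  | t :: F => by
    have h1 := weight_pruned_trunk t
    have h2 := weight_forestPruned_trunk F
    simp only [forestPruned, forestTrunk, forestWeight_append, forestWeight]; omega
end

mutual
theorem unmark_of_mem : ∀ (t : PTree D), ∀ c ∈ markings t, unmark c = t
  | node d F => by
    have := forestUnmark_of_mem F
    simp only [markings, List.mem_append, List.mem_map]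
    rintro c (⟨a, ha, rfl⟩ | ⟨a, ha, rfl⟩) <;> simp [unmark, this a ha]
theorem forestUnmark_of_mem : ∀ (F : List (PTree D)), ∀ c ∈ forestMarkings F, forestUnmark c = F
  | [] => by simp [forestMarkings, forestUnmark]
  | t :: F => by
    have h1 := unmark_of_mem t
    have h2 := forestUnmark_of_mem F
    simp only [forestMarkings, List.mem_flatMap, List.mem_map]
    rintro c ⟨a, ha, b, hb, rfl⟩
    simp [forestUnmark, h1 a ha, h2 b hb]
end

theorem weight_cut {F : PForest D} {c : PForest (D × Bool)} (hc : c ∈ cuts F) :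
    forestWeight (forestPruned c) + forestWeight (forestTrunk c) = forestWeight F := by
  rw [weight_forestPruned_trunk, ← weight_forestUnmark,
    forestUnmark_of_mem F c (List.mem_of_mem_filter hc)]

theorem eq_nil_of_forestWeight {F : PForest D} (h : forestWeight F = 0) : F = [] := by
  cases F with
  | nil => rfl
  | cons t F => cases t; simp [forestWeight, weight] at h

end PTree

/-- The free associative unital `ℚ`-algebra on the plane rooted trees decorated by `D`. -/
abbrev HPR (D : Type*) : Type _ := FreeAlgebra ℚ (PTree D)

namespace HPR

open PTree

variable {D : Type*}

/-- The monomial `t₁ ⋯ t_n` attached to a forest. -/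
noncomputable def mono (F : PForest D) : HPR D := (F.map (FreeAlgebra.ι ℚ)).prod

theorem mono_nil : mono ([] : PForest D) = 1 := rfl

theorem mono_cons (t : PTree D) (F : PForest D) :
    mono (t :: F) = FreeAlgebra.ι ℚ t * mono F := by simp [mono]

theorem mono_singleton (t : PTree D) : mono [t] = FreeAlgebra.ι ℚ t := by simp [mono]

theorem mono_append (F G : PForest D) : mono (F ++ G) = mono F * mono G := by simp [mono]

variable (D) in
/-- The basis of the free algebra formed by the monomials `mono F`, indexed by the forests. -/
noncomputable def forestBasis : Module.Basis (PForest D) ℚ (HPR D) :=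
  (FreeAlgebra.basisFreeMonoid ℚ (PTree D)).reindex FreeMonoid.toList

@[simp]
theorem forestBasis_apply (F : PForest D) : forestBasis D F = mono F := by
  have : forestBasis D F = FreeAlgebra.equivMonoidAlgebraFreeMonoid.symm
      (MonoidAlgebra.single (FreeMonoid.ofList F) (1 : ℚ)) := by
    simp [forestBasis, FreeAlgebra.basisFreeMonoid]
    try rfl
  rw [this]
  change MonoidAlgebra.lift ℚ (HPR D) (FreeMonoid (PTree D)) (FreeMonoid.lift (FreeAlgebra.ι ℚ))
    (MonoidAlgebra.single (FreeMonoid.ofList F) (1 : ℚ)) = _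
  simp [FreeMonoid.lift_ofList, mono]

/-- The counit: `1` on the empty forest, `0` on all other forests. -/
noncomputable def counitMap : HPR D →ₗ[ℚ] ℚ :=
  (forestBasis D).constr ℚ fun F => if F.isEmpty then 1 else 0

/-- The coproduct: `Δ(F) = ∑ P^c(F) ⊗ R^c(F)` over all admissible cuts `c` of the forest `F`. -/
noncomputable def comulMap : HPR D →ₗ[ℚ] HPR D ⊗[ℚ] HPR D :=
  (forestBasis D).constr ℚ fun F =>
    ((cuts F).map fun c => mono (forestPruned c) ⊗ₜ[ℚ] mono (forestTrunk c)).sum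

/-- The operator `B_d^+`: graft the trees of a forest, in their order, on a common root decorated
by `d`. -/
noncomputable def graft (d : D) : HPR D →ₗ[ℚ] HPR D :=
  (forestBasis D).constr ℚ fun F => mono [node d F]

theorem counitMap_mono (F : PForest D) : counitMap (mono F) = if F.isEmpty then 1 else 0 := by
  rw [← forestBasis_apply, counitMap, Module.Basis.constr_basis]

theorem comulMap_mono (F : PForest D) : comulMap (mono F) =
    ((cuts F).map fun c => mono (forestPruned c) ⊗ₜ[ℚ] mono (forestTrunk c)).sum := by
  rw [← forestBasis_apply, comulMap, Module.Basis.constr_basis]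

theorem graft_mono (d : D) (F : PForest D) : graft d (mono F) = mono [node d F] := by
  rw [← forestBasis_apply, graft, Module.Basis.constr_basis]

theorem comulMap_one : comulMap (1 : HPR D) = 1 := by
  rw [← mono_nil, comulMap_mono, cuts_nil]
  simp [forestPruned, forestTrunk, mono_nil, Algebra.TensorProduct.one_def]

theorem comulMap_mono_singleton (t : PTree D) : comulMap (mono [t]) =
    ((treeCuts t).map fun c => mono (pruned c) ⊗ₜ[ℚ] mono (trunk c)).sum := by
  rw [comulMap_mono, cuts_cons, cuts_nil]
  induction treeCuts t with
  | nil => simp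
  | cons a l ih =>
    rw [List.flatMap_cons, List.map_append, List.sum_append, ih]
    simp [forestPruned, forestTrunk]

theorem comulMap_mono_cons (t : PTree D) (F : PForest D) :
    comulMap (mono (t :: F)) = comulMap (mono [t]) * comulMap (mono F) := by
  rw [comulMap_mono_singleton, comulMap_mono, comulMap_mono, cuts_cons]
  induction treeCuts t with
  | nil => simp
  | cons a l ih =>
    rw [List.flatMap_cons, List.map_append, List.sum_append, ih, List.map_cons, List.sum_cons,
      add_mul]
    simp only [List.map_map, Function.comp_def, forestPruned, forestTrunk, mono_append,
      ← Algebra.TensorProduct.tmul_mul_tmul]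
    rw [List.sum_map_mul_left]

theorem comulMap_mono_append (F G : PForest D) :
    comulMap (mono (F ++ G)) = comulMap (mono F) * comulMap (mono G) := by
  induction F with
  | nil => simp [mono_nil, comulMap_one]
  | cons t F ih =>
    rw [List.cons_append, comulMap_mono_cons, ih, comulMap_mono_cons t F, mul_assoc]

/-- A linear map that is multiplicative on forests is multiplicative. -/
theorem hom_mul {A : Type*} [Ring A] [Algebra ℚ A] (f : HPR D →ₗ[ℚ] A)
    (h : ∀ F G, f (mono (F ++ G)) = f (mono F) * f (mono G)) (x y : HPR D) :
    f (x * y) = f x * f y := by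
  have : (LinearMap.mul ℚ (HPR D)).compr₂ f = (LinearMap.mul ℚ A).compl₁₂ f f := by
    refine (forestBasis D).ext fun F => (forestBasis D).ext fun G => ?_
    simp [← mono_append, h]
  exact LinearMap.congr_fun₂ this x y

theorem comulMap_mul (x y : HPR D) : comulMap (x * y) = comulMap x * comulMap y :=
  hom_mul comulMap comulMap_mono_append x y

theorem counitMap_one : counitMap (1 : HPR D) = 1 := by
  rw [← mono_nil, counitMap_mono]; rfl

theorem counitMap_mul (x y : HPR D) : counitMap (x * y) = counitMap x * counitMap y :=
  hom_mul counitMap (fun F G => by cases F <;> simp [counitMap_mono]) x y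

theorem comulMap_graft (d : D) (x : HPR D) :
    comulMap (graft d x) = graft d x ⊗ₜ 1 + (graft d).lTensor _ (comulMap x) := by
  have : comulMap ∘ₗ graft d = (TensorProduct.mk ℚ _ _).flip 1 ∘ₗ graft d +
      (graft d).lTensor _ ∘ₗ comulMap := by
    refine (forestBasis D).ext fun F => ?_
    simp only [forestBasis_apply, LinearMap.comp_apply, LinearMap.add_apply, graft_mono]
    rw [comulMap_mono_singleton, treeCuts_node, comulMap_mono, map_list_sum, List.map_cons,
      List.map_map, List.map_map, List.sum_cons]
    congr 1
    · simp [pruned, trunk, unmark, forestUnmark_plain, mono_nil]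
    · simp [Function.comp_def, pruned, trunk, graft_mono]
  exact LinearMap.congr_fun this x

variable (D) in
/-- The coproduct as an algebra morphism. -/
noncomputable def comulHom : HPR D →ₐ[ℚ] HPR D ⊗[ℚ] HPR D :=
  AlgHom.ofLinearMap comulMap comulMap_one comulMap_mul

variable (D) in
/-- The counit as an algebra morphism. -/
noncomputable def counitHom : HPR D →ₐ[ℚ] ℚ :=
  AlgHom.ofLinearMap counitMap counitMap_one counitMap_mul

theorem comulHom_graft (d : D) (x : HPR D) :
    comulHom D (graft d x) = graft d x ⊗ₜ 1 + (graft d).lTensor _ (comulHom D x) :=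
  comulMap_graft d x

/-- Two algebra morphisms are equal if their equality is preserved by all the `B_d^+`. -/
theorem algHom_ext {A : Type*} [Ring A] [Algebra ℚ A] (f g : HPR D →ₐ[ℚ] A)
    (h : ∀ d x, f x = g x → f (graft d x) = g (graft d x)) : f = g := by
  ext t
  simp only [Function.comp_apply]
  induction t using PTree.ind with
  | h d F ih =>
    rw [← mono_singleton, ← graft_mono]
    refine h d _ ?_
    rw [mono, map_list_prod, map_list_prod, List.map_map, List.map_map]
    congr 1
    exact List.map_congr_left ih

theorem counitMap_graft (d : D) (x : HPR D) : counitMap (graft d x) = 0 := by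
  have : counitMap ∘ₗ graft d = 0 := (forestBasis D).ext fun F => by
    simp [graft_mono, counitMap_mono]
  exact LinearMap.congr_fun this x

theorem coassoc_aux :
    (Algebra.TensorProduct.assoc ℚ ℚ ℚ (HPR D) (HPR D) (HPR D)).toAlgHom.comp
      ((Algebra.TensorProduct.map (comulHom D) (.id ℚ (HPR D))).comp (comulHom D))
      = (Algebra.TensorProduct.map (.id ℚ (HPR D)) (comulHom D)).comp (comulHom D) := by
  refine algHom_ext _ _ fun d x hx => ?_
  have h1 : ∀ z : HPR D ⊗[ℚ] HPR D,
      Algebra.TensorProduct.assoc ℚ ℚ ℚ (HPR D) (HPR D) (HPR D)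
        (Algebra.TensorProduct.map (comulHom D) (.id ℚ (HPR D)) ((graft d).lTensor _ z)) =
      ((graft d).lTensor _).lTensor _ (Algebra.TensorProduct.assoc ℚ ℚ ℚ (HPR D) (HPR D) (HPR D)
        (Algebra.TensorProduct.map (comulHom D) (.id ℚ (HPR D)) z)) := by
    intro z
    induction z with
    | zero => simp
    | add a b ha hb => simp only [map_add, ha, hb]
    | tmul a b =>
      simp only [LinearMap.lTensor_tmul, Algebra.TensorProduct.map_tmul, AlgHom.coe_id, id]
      induction comulHom D a with
      | zero => simp
      | add a b ha hb => simp only [map_add, TensorProduct.add_tmul, ha, hb]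
      | tmul a b => simp
  have h2 : ∀ z : HPR D ⊗[ℚ] HPR D,
      Algebra.TensorProduct.map (.id ℚ (HPR D)) (comulHom D) ((graft d).lTensor _ z) =
      Algebra.TensorProduct.assoc ℚ ℚ ℚ (HPR D) (HPR D) (HPR D) ((graft d).lTensor _ z ⊗ₜ 1) +
      ((graft d).lTensor _).lTensor _
        (Algebra.TensorProduct.map (.id ℚ (HPR D)) (comulHom D) z) := by
    intro z
    induction z with
    | zero => simp
    | add a b ha hb =>
      simp only [map_add, ha, hb, TensorProduct.add_tmul]
      abel
    | tmul a b => simp [comulHom_graft, TensorProduct.tmul_add]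
  have hx' : Algebra.TensorProduct.assoc ℚ ℚ ℚ (HPR D) (HPR D) (HPR D)
      (Algebra.TensorProduct.map (comulHom D) (.id ℚ (HPR D)) (comulHom D x)) =
      Algebra.TensorProduct.map (.id ℚ (HPR D)) (comulHom D) (comulHom D x) := hx
  change Algebra.TensorProduct.assoc ℚ ℚ ℚ (HPR D) (HPR D) (HPR D)
      (Algebra.TensorProduct.map (comulHom D) (.id ℚ (HPR D)) (comulHom D (graft d x))) =
      Algebra.TensorProduct.map (.id ℚ (HPR D)) (comulHom D) (comulHom D (graft d x))
  rw [comulHom_graft, map_add, map_add, map_add, h1, h2, hx', Algebra.TensorProduct.map_tmul,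
    comulHom_graft, Algebra.TensorProduct.map_tmul, map_one, TensorProduct.add_tmul, map_add]
  simp [Algebra.TensorProduct.one_def, add_assoc]

theorem rTensor_aux :
    (Algebra.TensorProduct.map (counitHom D) (.id ℚ (HPR D))).comp (comulHom D)
      = (Algebra.TensorProduct.lid ℚ (HPR D)).symm := by
  refine algHom_ext _ _ fun d x hx => ?_
  have h1 : ∀ z : HPR D ⊗[ℚ] HPR D,
      Algebra.TensorProduct.map (counitHom D) (.id ℚ (HPR D)) ((graft d).lTensor _ z) =
      (graft d).lTensor _ (Algebra.TensorProduct.map (counitHom D) (.id ℚ (HPR D)) z) := by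
    intro z
    induction z with
    | zero => simp
    | add a b ha hb => simp only [map_add, ha, hb]
    | tmul a b => simp
  have hx' : Algebra.TensorProduct.map (counitHom D) (.id ℚ (HPR D)) (comulHom D x) =
    1 ⊗ₜ x := hx
  change Algebra.TensorProduct.map (counitHom D) (.id ℚ (HPR D)) (comulHom D (graft d x)) =
    1 ⊗ₜ graft d x
  have h0 : counitHom D (graft d x) = 0 := counitMap_graft d x
  rw [comulHom_graft, map_add, h1, hx', Algebra.TensorProduct.map_tmul, h0]
  simp

theorem lTensor_aux :
    (Algebra.TensorProduct.map (.id ℚ (HPR D)) (counitHom D)).comp (comulHom D)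
      = (Algebra.TensorProduct.rid ℚ ℚ (HPR D)).symm := by
  refine algHom_ext _ _ fun d x hx => ?_
  have h0 : ∀ y, counitHom D (graft d y) = 0 := counitMap_graft d
  have h1 : ∀ z : HPR D ⊗[ℚ] HPR D,
      Algebra.TensorProduct.map (.id ℚ (HPR D)) (counitHom D) ((graft d).lTensor _ z) = 0 := by
    intro z
    induction z with
    | zero => simp
    | add a b ha hb => simp only [map_add, ha, hb, add_zero]
    | tmul a b => simp [h0]
  change Algebra.TensorProduct.map (.id ℚ (HPR D)) (counitHom D) (comulHom D (graft d x)) =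
    graft d x ⊗ₜ 1
  rw [comulHom_graft, map_add, h1, Algebra.TensorProduct.map_tmul]
  simp

noncomputable instance : Coalgebra ℚ (HPR D) where
  comul := comulMap
  counit := counitMap
  coassoc := congr(($coassoc_aux).toLinearMap)
  rTensor_counit_comp_comul := congr(($rTensor_aux).toLinearMap)
  lTensor_counit_comp_comul := congr(($lTensor_aux).toLinearMap)

noncomputable instance : Bialgebra ℚ (HPR D) :=
  Bialgebra.mk' ℚ (HPR D) counitMap_one (fun {x y} => counitMap_mul x y) comulMap_one
    (fun {x y} => comulMap_mul x y)

open WithConv in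
/-- The convolution powers of `ηε - id`. -/
noncomputable def convPow (k : ℕ) : WithConv (HPR D →ₗ[ℚ] HPR D) :=
  (1 - toConv LinearMap.id) ^ k

open WithConv in
/-- The antipode: the convolution inverse `∑ k, (ηε - id) ^ k` of the identity, a sum that is
finite on every forest. -/
noncomputable def antipodeMap : HPR D →ₗ[ℚ] HPR D :=
  (forestBasis D).constr ℚ fun F =>
    ∑ k ∈ Finset.range (forestWeight F + 1), (convPow k).ofConv (mono F)

open WithConv in
theorem conv_mono (f g : WithConv (HPR D →ₗ[ℚ] HPR D)) (F : PForest D) :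
    (f * g).ofConv (mono F) =
      ((cuts F).map fun c => f.ofConv (mono (forestPruned c)) *
        g.ofConv (mono (forestTrunk c))).sum := by
  change LinearMap.mul' ℚ (HPR D) (TensorProduct.map f.ofConv g.ofConv (comulMap (mono F))) = _
  rw [comulMap_mono, map_list_sum, map_list_sum, List.map_map, List.map_map]
  simp [Function.comp_def]

open WithConv in
theorem conv_congr {f f' g g' : WithConv (HPR D →ₗ[ℚ] HPR D)} {n : ℕ}
    (hf : ∀ F, forestWeight F ≤ n → f.ofConv (mono F) = f'.ofConv (mono F))
    (hg : ∀ F, forestWeight F ≤ n → g.ofConv (mono F) = g'.ofConv (mono F))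
    {F : PForest D} (hF : forestWeight F ≤ n) :
    (f * g).ofConv (mono F) = (f' * g').ofConv (mono F) := by
  rw [conv_mono, conv_mono]
  congr 1
  refine List.map_congr_left fun c hc => ?_
  have := weight_cut hc
  rw [hf _ (by omega), hg _ (by omega)]

open WithConv in
theorem convPow_mono_eq_zero (k : ℕ) : ∀ F : PForest D, forestWeight F < k →
    (convPow k).ofConv (mono F) = 0 := by
  induction k with
  | zero => intro F h; omega
  | succ k ih =>
    intro F hF
    rw [convPow, pow_succ, conv_mono]
    refine List.sum_eq_zero fun y hy => ?_
    obtain ⟨c, hc, rfl⟩ := List.mem_map.1 hy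
    have hw := weight_cut hc
    by_cases h : forestWeight (forestTrunk c) = 0
    · rw [eq_nil_of_forestWeight h, mono_nil]
      have : (1 - toConv LinearMap.id : WithConv (HPR D →ₗ[ℚ] HPR D)).ofConv 1 = 0 := by
        change algebraMap ℚ (HPR D) (counitMap 1) - 1 = 0
        rw [counitMap_one]; simp
      rw [this, mul_zero]
    · have := ih (forestPruned c) (by omega)
      rw [convPow] at this
      rw [this, zero_mul]

open WithConv in
theorem antipodeMap_mono {n : ℕ} (F : PForest D) (hF : forestWeight F ≤ n) :
    antipodeMap (mono F) =
      (∑ k ∈ Finset.range (n + 1), convPow k : WithConv (HPR D →ₗ[ℚ] HPR D)).ofConv (mono F) := by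
  have h1 : antipodeMap (mono F) =
      ∑ k ∈ Finset.range (forestWeight F + 1), (convPow k).ofConv (mono F) := by
    rw [← forestBasis_apply, antipodeMap, Module.Basis.constr_basis, forestBasis_apply]
  have h2 : (∑ k ∈ Finset.range (n + 1), convPow k :
      WithConv (HPR D →ₗ[ℚ] HPR D)).ofConv (mono F) =
      ∑ k ∈ Finset.range (n + 1), (convPow k).ofConv (mono F) := by
    simp
  rw [h1, h2]
  refine Finset.sum_subset (fun i hi => ?_) fun i _ hi => ?_
  · simp only [Finset.mem_range] at *; omega
  · exact convPow_mono_eq_zero i F (by simp only [Finset.mem_range] at hi; omega)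

open WithConv in
theorem antipode_convMul_id :
    (toConv antipodeMap * toConv LinearMap.id : WithConv (HPR D →ₗ[ℚ] HPR D)) = 1 := by
  refine WithConv.ext ((forestBasis D).ext fun F => ?_)
  rw [forestBasis_apply, conv_congr (f := toConv antipodeMap) (f' := ∑ k ∈ Finset.range (forestWeight F + 1), convPow k)
    (fun G hG => antipodeMap_mono G hG) (fun _ _ => rfl) le_rfl]
  have h' := geom_sum_mul_neg (1 - toConv LinearMap.id : WithConv (HPR D →ₗ[ℚ] HPR D))
    (forestWeight F + 1)
  rw [sub_sub_cancel] at h'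
  have e : (∑ k ∈ Finset.range (forestWeight F + 1), convPow k) * toConv LinearMap.id =
    (1 : WithConv (HPR D →ₗ[ℚ] HPR D)) - convPow (forestWeight F + 1) := h'
  rw [e, ofConv_sub, LinearMap.sub_apply, convPow_mono_eq_zero _ F (by omega), sub_zero]

open WithConv in
theorem id_convMul_antipode :
    (toConv LinearMap.id * toConv antipodeMap : WithConv (HPR D →ₗ[ℚ] HPR D)) = 1 := by
  refine WithConv.ext ((forestBasis D).ext fun F => ?_)
  rw [forestBasis_apply, conv_congr (g := toConv antipodeMap) (g' := ∑ k ∈ Finset.range (forestWeight F + 1), convPow k)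
    (fun _ _ => rfl) (fun G hG => antipodeMap_mono G hG) le_rfl]
  have h := mul_neg_geom_sum (1 - toConv LinearMap.id : WithConv (HPR D →ₗ[ℚ] HPR D))
    (forestWeight F + 1)
  rw [sub_sub_cancel] at h
  have e : toConv LinearMap.id * (∑ k ∈ Finset.range (forestWeight F + 1), convPow k) =
    (1 : WithConv (HPR D →ₗ[ℚ] HPR D)) - convPow (forestWeight F + 1) := h
  rw [e, ofConv_sub, LinearMap.sub_apply, convPow_mono_eq_zero _ F (by omega), sub_zero]

noncomputable instance : HopfAlgebra ℚ (HPR D) :=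
  HopfAlgebra.ofConvInverse antipodeMap antipode_convMul_id id_convMul_antipode

open Classical in
/-- The operator `γ_d`: it sends `t₁ ⋯ t_n` to `t₁ ⋯ t_{n-1}` if `t_n` is the one-vertex tree
decorated by `d`, and every other forest (the empty one included) to `0`. -/
noncomputable def cutLast (d : D) : HPR D →ₗ[ℚ] HPR D :=
  (forestBasis D).constr ℚ fun F =>
    if F.getLast? = some (node d []) then mono F.dropLast else 0

variable (D) in
/-- The homogeneous elements of weight `n`. -/
def homogeneous (n : ℕ) : Submodule ℚ (HPR D) :=
  Submodule.span ℚ {x | ∃ F : PForest D, forestWeight F = n ∧ x = mono F}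

variable (D) in
/-- The primitive elements. -/
def primitives : Submodule ℚ (HPR D) where
  carrier := {x | Coalgebra.comul (R := ℚ) x = x ⊗ₜ[ℚ] 1 + 1 ⊗ₜ[ℚ] x}
  zero_mem' := by simp
  add_mem' {x y} hx hy := by
    simp only [Set.mem_ofPred_eq] at hx hy ⊢
    rw [map_add, hx, hy, TensorProduct.add_tmul, TensorProduct.tmul_add]
    abel
  smul_mem' r x hx := by
    simp only [Set.mem_ofPred_eq] at hx ⊢
    rw [map_smul, hx, smul_add, TensorProduct.smul_tmul', TensorProduct.tmul_smul]

/-- The three conditions that characterize the bilinear form. In the second one `B.tmul B` is the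
form on the tensor square with `(x₁ ⊗ x₂, y₁ ⊗ y₂) = (x₁, y₁) (x₂, y₂)`. -/
structure IsPairing (B : LinearMap.BilinForm ℚ (HPR D)) : Prop where
  one_left : ∀ x, B 1 x = Coalgebra.counit (R := ℚ) x
  mul_left : ∀ x₁ x₂ y, B (x₁ * x₂) y = B.tmul B (x₁ ⊗ₜ[ℚ] x₂) (Coalgebra.comul (R := ℚ) y)
  graft_left : ∀ x y d, B (graft d x) y = B x (cutLast d y)

open Classical in
/-- The family `e` satisfies `(e_F, G) = δ_{F,G}` for all forests `F`, `G`. -/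
def IsDualFamily (B : LinearMap.BilinForm ℚ (HPR D)) (e : PForest D → HPR D) : Prop :=
  ∀ F G, B (e F) (mono G) = if F = G then 1 else 0

end HPR

namespace HPR

open PTree

variable {D : Type*}

-- The first two axioms say that `x ↦ (x, ·)` is an algebra morphism from `H` to its dual with the
-- convolution product; the third gives its value at `B_d^+(F)` from its value at `F`. As `H` is
-- free on trees and every tree is some `B_d^+(F)` with `F` of smaller weight, exactly one such form
-- exists (`isPairing_pairing`, `IsPairing.eq`).
--
-- The rule `cutLast_mul` for `γ_d` on products is the transpose of `Δ ∘ B_d^+ = B_d^+ ⊗ 1 + (id ⊗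
-- B_d^+) ∘ Δ`. Hence the transposed form satisfies the same axioms (`IsPairing.flip`), and
-- uniqueness makes the form symmetric. Product and coproduct are then adjoint on both sides, and
-- `S` is self-adjoint because a convolution inverse is unique.
--
-- Weight components are infinite-dimensional when `D` is infinite, so non-degeneracy alone would
-- not give a dual family. It is built directly in `IsPairing.exists_eq_coord`: if `u` and `v` are
-- dual to `G` and `T`, then `u B_d^+(v)` is dual to `T B_d^+(G)` up to forests whose last tree is
-- lighter than `B_d^+(G)`. These are finitely many (`IsPairing.finite_support`, from
-- `finite_graftings`) and are subtracted by induction. Non-degeneracy and the dual basis follow;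
-- adjunction turns concatenation of forests into deconcatenation of the `e_F`, and identifies the
-- primitive elements.

theorem form_ext {M : Type*} [AddCommGroup M] [Module ℚ M] {f g : HPR D →ₗ[ℚ] HPR D →ₗ[ℚ] M}
    (h : ∀ F G, f (mono F) (mono G) = g (mono F) (mono G)) : f = g :=
  (forestBasis D).ext fun F => (forestBasis D).ext fun G => by simpa using h F G

/-- A nonempty forest is uniquely `B_d^+(F) G`, the shape on which axioms 2 and 3 compute a pairing
recursively. -/
theorem forest_induction {p : PForest D → Prop} (nil : p [])
    (cons : ∀ d F G, p F → p G → p (node d F :: G)) : ∀ F, p F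
  | [] => nil
  | node d F :: G => cons d F G (forest_induction nil cons F) (forest_induction nil cons G)

-- The operators `γ_d` on products and on grafted trees

open Classical in
theorem cutLast_mono (d : D) (F : PForest D) : cutLast d (mono F) =
    if F.getLast? = some (node d []) then mono F.dropLast else 0 := by
  rw [← forestBasis_apply, cutLast, Module.Basis.constr_basis]

theorem cutLast_one (d : D) : cutLast d (1 : HPR D) = 0 := by
  rw [← mono_nil, cutLast_mono]; simp

open Classical in
theorem cutLast_mono_concat (d : D) (F : PForest D) (t : PTree D) :
    cutLast d (mono (F ++ [t])) = if t = node d [] then mono F else 0 := by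
  simp [cutLast_mono]

/-- Only the last tree of a product matters, and it belongs to `y` unless `y` is the empty forest,
which `counitMap y` detects. -/
theorem cutLast_mul (d : D) (x y : HPR D) :
    cutLast d (x * y) = x * cutLast d y + counitMap y • cutLast d x := by
  have : (LinearMap.mul ℚ (HPR D)).compr₂ (cutLast d) =
      (LinearMap.mul ℚ (HPR D)).compl₂ (cutLast d) +
      ((LinearMap.lsmul ℚ (HPR D)).flip.compl₁₂ (cutLast d) counitMap) := by
    refine form_ext fun F G => ?_
    rcases List.eq_nil_or_concat G with rfl | ⟨G, t, rfl⟩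
    · simp [mono_nil, cutLast_one, counitMap_one]
    · simp only [LinearMap.compr₂_apply, LinearMap.mul_apply_apply, LinearMap.add_apply,
        LinearMap.compl₂_apply, LinearMap.compl₁₂_apply, LinearMap.flip_apply,
        LinearMap.lsmul_apply, List.concat_eq_append, ← mono_append, counitMap_mono]
      rw [← List.append_assoc, cutLast_mono_concat, cutLast_mono_concat]
      split_ifs <;> simp_all [mono_append]
  exact LinearMap.congr_fun₂ this x y

open Classical in
theorem cutLast_graft (d d' : D) (x : HPR D) :
    cutLast d (graft d' x) = if d' = d then counitMap x • (1 : HPR D) else 0 := by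
  have : cutLast d ∘ₗ graft d' =
      if d' = d then (LinearMap.toSpanSingleton ℚ (HPR D) 1) ∘ₗ counitMap else 0 := by
    refine (forestBasis D).ext fun F => ?_
    rw [forestBasis_apply, LinearMap.comp_apply, graft_mono]
    have := cutLast_mono_concat d [] (node d' F)
    rw [List.nil_append] at this
    rw [this]
    by_cases h : d' = d
    · cases F <;> simp [h, counitMap_mono, counitMap_one, mono_nil]
    · simp [h]
  rw [← LinearMap.comp_apply, this]
  split_ifs <;> simp

-- Existence of the form

section Existence

open WithConv

mutual
/-- The linear form `(t, ·)` attached to a tree. -/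
noncomputable def treeForm : PTree D → WithConv (HPR D →ₗ[ℚ] ℚ)
  | node d F => toConv ((forestForm F).ofConv ∘ₗ cutLast d)
/-- The linear form `(F, ·)` attached to a forest. -/
noncomputable def forestForm : List (PTree D) → WithConv (HPR D →ₗ[ℚ] ℚ)
  | [] => 1
  | t :: F => treeForm t * forestForm F
end

/-- Associativity of convolution, that is, coassociativity of `Δ`; it becomes axiom 2 for `pairing`.
-/
theorem forestForm_append (F G : PForest D) :
    forestForm (F ++ G) = forestForm F * forestForm G := by
  induction F with
  | nil => simp [forestForm]
  | cons t F ih => rw [List.cons_append, forestForm, ih, forestForm, mul_assoc]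

variable (D) in
/-- The bilinear form with `(t₁ ⋯ t_n, ·) = (t₁, ·) * ⋯ * (t_n, ·)` and
`(B_d^+(x), ·) = (x, γ_d(·))`. -/
noncomputable def pairing : LinearMap.BilinForm ℚ (HPR D) :=
  (forestBasis D).constr ℚ fun F => (forestForm F).ofConv

theorem pairing_mono (F : PForest D) : pairing D (mono F) = (forestForm F).ofConv := by
  rw [← forestBasis_apply, pairing, Module.Basis.constr_basis]

theorem tmul_apply_tmul_left (B : LinearMap.BilinForm ℚ (HPR D)) (x₁ x₂ : HPR D)
    (z : HPR D ⊗[ℚ] HPR D) : B.tmul B (x₁ ⊗ₜ[ℚ] x₂) z =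
      LinearMap.mul' ℚ ℚ (TensorProduct.map (B x₁) (B x₂) z) := by
  induction z with
  | zero => simp
  | add a b ha hb => rw [map_add, ha, hb, map_add, map_add]
  | tmul a b => simp [mul_comm]

theorem isPairing_pairing : IsPairing (pairing D) where
  one_left x := by
    rw [← mono_nil, pairing_mono, forestForm]; rfl
  mul_left x₁ x₂ y := by
    have : (LinearMap.mul ℚ (HPR D)).compr₂ (pairing D) =
        ((TensorProduct.mk ℚ (HPR D) (HPR D)).compr₂
          ((LinearMap.BilinForm.tmul (pairing D) (pairing D)).compl₂ comulMap)) := by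
      refine form_ext fun F G => LinearMap.ext fun y => ?_
      simp only [LinearMap.compr₂_apply, LinearMap.mul_apply_apply, ← mono_append, pairing_mono,
        forestForm_append, TensorProduct.mk_apply, LinearMap.compl₂_apply, tmul_apply_tmul_left]
      rfl
    exact LinearMap.congr_fun (LinearMap.congr_fun₂ this x₁ x₂) y
  graft_left x y d := by
    have : pairing D ∘ₗ graft d = (pairing D).compl₂ (cutLast d) := by
      refine (forestBasis D).ext fun F => LinearMap.ext fun y => ?_
      simp [graft_mono, pairing_mono, forestForm, treeForm]
    exact LinearMap.congr_fun₂ this x y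

end Existence

-- Uniqueness of the form

/-- Axioms 2 and 3 combined into one recursion, which determines the form and later controls its
support. -/
theorem IsPairing.mono_cons_apply {B : LinearMap.BilinForm ℚ (HPR D)} (h : IsPairing B) (d : D)
    (F G : PForest D) (y : HPR D) : B (mono (node d F :: G)) y =
      LinearMap.mul' ℚ ℚ
        (TensorProduct.map (B (mono F) ∘ₗ cutLast d) (B (mono G)) (comulMap y)) := by
  have : B (graft d (mono F)) = B (mono F) ∘ₗ cutLast d :=
    LinearMap.ext fun z => h.graft_left _ z d
  rw [mono_cons, ← mono_singleton, h.mul_left, tmul_apply_tmul_left, ← graft_mono, this]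
  rfl

theorem IsPairing.eq {B B' : LinearMap.BilinForm ℚ (HPR D)} (h : IsPairing B)
    (h' : IsPairing B') : B = B' := by
  refine (forestBasis D).ext fun F => ?_
  rw [forestBasis_apply]
  induction F using forest_induction with
  | nil => ext y; rw [mono_nil, h.one_left, h'.one_left]
  | cons d F G hF hG =>
    ext y
    rw [h.mono_cons_apply, h'.mono_cons_apply, hF, hG]

theorem exists_comulMap_eq_sum (x : HPR D) : ∃ (s : Finset (HPR D × HPR D))
    (l r : HPR D × HPR D → HPR D), comulMap x = ∑ i ∈ s, l i ⊗ₜ[ℚ] r i :=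
  let R := Coalgebra.Repr.arbitrary ℚ x
  ⟨R.index, R.left, R.right, R.eq.symm⟩

-- Symmetry: the axioms for the transposed form

namespace IsPairing

variable {B : LinearMap.BilinForm ℚ (HPR D)}

theorem one_right (h : IsPairing B) (x : HPR D) : B x 1 = counitMap x := by
  have : LinearMap.flip B 1 = counitMap := by
    refine (forestBasis D).ext fun F => ?_
    rw [forestBasis_apply, LinearMap.flip_apply, counitMap_mono]
    cases F with
    | nil => rw [mono_nil, h.one_left]; exact counitMap_one
    | cons t F =>
      obtain ⟨d, G⟩ := t
      rw [h.mono_cons_apply, comulMap_one, Algebra.TensorProduct.one_def]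
      simp [cutLast_one]
  exact LinearMap.congr_fun this x

/-- By `comulMap_graft`, the term `graft d y ⊗ 1` of the coproduct gives the first summand, and the
other terms carry the grafting to the second factor, where `h₂` applies. -/
theorem mul_graft (h : IsPairing B) (d : D) (x₁ x₂ y : HPR D)
    (h₂ : ∀ y, B x₂ (graft d y) = B (cutLast d x₂) y) :
    B (x₁ * x₂) (graft d y) = B x₁ (graft d y) * counitMap x₂ + B (x₁ * cutLast d x₂) y := by
  rw [h.mul_left, h.mul_left]
  change B.tmul B _ (comulMap (graft d y)) = _ + B.tmul B _ (comulMap y)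
  rw [comulMap_graft, map_add]
  congr 1
  · simp [h.one_right, mul_comm]
  · induction comulMap y with
    | zero => simp
    | add a b ha hb => rw [map_add, map_add, map_add, ha, hb]
    | tmul a b => simp [h₂]

/-- Axiom 3 transposed. On two grafted trees both sides reduce to counits by `cutLast_graft`; the
induction over forests then works because `mul_graft` and `cutLast_mul` have the same two terms. -/
theorem graft_right (h : IsPairing B) (x y : HPR D) (d : D) :
    B x (graft d y) = B (cutLast d x) y := by
  classical
  have hg : ∀ (d' : D) (x y : HPR D), B (graft d' x) (graft d y) =
      B (cutLast d (graft d' x)) y := by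
    intro d' x y
    rw [h.graft_left, cutLast_graft, cutLast_graft]
    by_cases hd : d = d'
    · subst hd
      simp only [if_true, map_smul, LinearMap.smul_apply, h.one_right, h.one_left, smul_eq_mul]
      exact mul_comm _ _
    · simp [hd, Ne.symm hd]
  have : B.compl₂ (graft d) = B ∘ₗ cutLast d := by
    refine (forestBasis D).ext fun F => ?_
    rw [forestBasis_apply]
    induction F with
    | nil =>
      ext y
      rw [mono_nil, LinearMap.compl₂_apply, h.one_left, LinearMap.comp_apply, cutLast_one,
        map_zero, LinearMap.zero_apply]
      exact counitMap_graft d y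
    | cons t F ih =>
      obtain ⟨d', G⟩ := t
      ext y
      rw [LinearMap.compl₂_apply, LinearMap.comp_apply, mono_cons, ← mono_singleton, ← graft_mono,
        h.mul_graft d _ _ _ fun y => LinearMap.congr_fun ih y, cutLast_mul, map_add,
        LinearMap.add_apply, add_comm, hg, map_smul, LinearMap.smul_apply, smul_eq_mul,
        mul_comm (counitMap _)]
  exact LinearMap.congr_fun₂ this x y

/-- The transposed axiom 2 passes to products in the left argument because `Δ` is multiplicative:
both sides expand to the same fourfold sum over the terms of the four coproducts. -/
theorem mul_right_of_mul (h : IsPairing B) (x x' : HPR D)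
    (hx : ∀ y₁ y₂, B x (y₁ * y₂) = B.tmul B (comulMap x) (y₁ ⊗ₜ y₂))
    (hx' : ∀ y₁ y₂, B x' (y₁ * y₂) = B.tmul B (comulMap x') (y₁ ⊗ₜ y₂)) (y₁ y₂ : HPR D) :
    B (x * x') (y₁ * y₂) = B.tmul B (comulMap (x * x')) (y₁ ⊗ₜ y₂) := by
  rw [h.mul_left, comulMap_mul]
  change B.tmul B _ (comulMap (y₁ * y₂)) = _
  rw [comulMap_mul]
  obtain ⟨s₁, l₁, r₁, e₁⟩ := exists_comulMap_eq_sum y₁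
  obtain ⟨s₂, l₂, r₂, e₂⟩ := exists_comulMap_eq_sum y₂
  obtain ⟨s, l, r, e⟩ := exists_comulMap_eq_sum x
  obtain ⟨s', l', r', e'⟩ := exists_comulMap_eq_sum x'
  have h₁ : ∀ a b, B (a * b) y₁ = ∑ i ∈ s₁, B a (l₁ i) * B b (r₁ i) := fun a b => by
    rw [h.mul_left]
    change B.tmul B _ (comulMap y₁) = _
    simp [e₁, mul_comm]
  have h₂ : ∀ a b, B (a * b) y₂ = ∑ i ∈ s₂, B a (l₂ i) * B b (r₂ i) := fun a b => by
    rw [h.mul_left]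
    change B.tmul B _ (comulMap y₂) = _
    simp [e₂, mul_comm]
  have hl : B.tmul B (x ⊗ₜ x') (comulMap y₁ * comulMap y₂) =
      ∑ i ∈ s₁, ∑ j ∈ s₂, ∑ k ∈ s, ∑ m ∈ s',
        (B (l k) (l₁ i) * B (r k) (l₂ j)) * (B (l' m) (r₁ i) * B (r' m) (r₂ j)) := by
    rw [e₁, e₂]
    simp only [Finset.sum_mul_sum, Algebra.TensorProduct.tmul_mul_tmul, map_sum,
      LinearMap.BilinForm.tensorDistrib_tmul, hx, hx', smul_eq_mul, e, e', LinearMap.sum_apply]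
    refine Finset.sum_congr rfl fun i _ => Finset.sum_congr rfl fun j _ => ?_
    rw [Finset.sum_comm]
    refine Finset.sum_congr rfl fun k _ => Finset.sum_congr rfl fun m _ => by ring
  have hr : B.tmul B (comulMap x * comulMap x') (y₁ ⊗ₜ y₂) =
      ∑ k ∈ s, ∑ m ∈ s', ∑ i ∈ s₁, ∑ j ∈ s₂,
        (B (l k) (l₁ i) * B (r k) (l₂ j)) * (B (l' m) (r₁ i) * B (r' m) (r₂ j)) := by
    rw [e, e']
    simp only [Finset.sum_mul_sum, Algebra.TensorProduct.tmul_mul_tmul, map_sum,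
      LinearMap.BilinForm.tensorDistrib_tmul, h₁, h₂, smul_eq_mul, LinearMap.sum_apply]
    refine Finset.sum_congr rfl fun k _ => Finset.sum_congr rfl fun m _ => ?_
    rw [Finset.sum_comm]
    refine Finset.sum_congr rfl fun i _ => Finset.sum_congr rfl fun j _ => by ring
  rw [hl, hr]
  -- The order of summation `i, j, k, m` is changed to `k, m, i, j`.
  refine (Finset.sum_congr rfl fun i _ => Finset.sum_comm).trans (Finset.sum_comm.trans ?_)
  refine Finset.sum_congr rfl fun k _ => ?_
  exact (Finset.sum_congr rfl fun i _ => Finset.sum_comm).trans Finset.sum_comm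

/-- By `mul_right_of_mul` only trees `B_d^+(F)` remain, and there the two terms of `cutLast_mul`
match those of `comulMap_graft`. -/
theorem mul_right (h : IsPairing B) (x y₁ y₂ : HPR D) :
    B x (y₁ * y₂) = B.tmul B (comulMap x) (y₁ ⊗ₜ y₂) := by
  have key : ∀ F : PForest D, ∀ y₁ y₂,
      B (mono F) (y₁ * y₂) = B.tmul B (comulMap (mono F)) (y₁ ⊗ₜ y₂) := by
    intro F
    induction F using forest_induction with
    | nil =>
      intro y₁ y₂
      rw [mono_nil, comulMap_one, Algebra.TensorProduct.one_def,
        LinearMap.BilinForm.tensorDistrib_tmul, h.one_left, h.one_left, h.one_left]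
      exact (counitMap_mul y₁ y₂).trans (mul_comm _ _)
    | cons d F G hF hG =>
      rw [mono_cons, ← mono_singleton]
      refine h.mul_right_of_mul _ _ (fun y₁ y₂ => ?_) hG
      rw [← graft_mono, h.graft_left, cutLast_mul, map_add, hF, map_smul, ← h.graft_left,
        comulMap_graft, map_add, LinearMap.add_apply, add_comm]
      congr 1
      · rw [LinearMap.BilinForm.tensorDistrib_tmul, h.one_left]; rfl
      · induction comulMap (mono F) with
        | zero => simp
        | add a b ha hb => simp only [map_add, LinearMap.add_apply, ha, hb]
        | tmul a b => simp [h.graft_left]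
  have : LinearMap.flip B (y₁ * y₂) = LinearMap.flip (B.tmul B) (y₁ ⊗ₜ y₂) ∘ₗ comulMap :=
    (forestBasis D).ext fun F => by simpa using key F y₁ y₂
  exact LinearMap.congr_fun this x

theorem flip (h : IsPairing B) : IsPairing (LinearMap.flip B) where
  one_left := h.one_right
  mul_left x₁ x₂ y := by
    have : ∀ z z', (LinearMap.BilinForm.tmul (LinearMap.flip B) (LinearMap.flip B)) z z' =
        B.tmul B z' z := by
      intro z z'
      induction z with
      | zero => simp
      | add a b ha hb => simp only [map_add, LinearMap.add_apply, ha, hb]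
      | tmul a b => induction z' with
        | zero => simp
        | add a b ha hb => simp only [map_add, LinearMap.add_apply, ha, hb]
        | tmul a b => rfl
    rw [this]
    exact h.mul_right y x₁ x₂
  graft_left x y d := h.graft_right y x d

theorem symm (h : IsPairing B) (x y : HPR D) : B x y = B y x :=
  LinearMap.congr_fun₂ (h.eq h.flip) x y

-- The antipode is self-adjoint

-- In the convolution algebra dual to the coalgebra `H ⊗ H`, the form `(S(x), y)` is a left inverse
-- of `(x, y)` and `(x, S(y))` is a right inverse, so the two coincide.
open WithConv in
theorem antipode_left (h : IsPairing B) (x y : HPR D) :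
    B (HopfAlgebra.antipode ℚ x) y = B x (HopfAlgebra.antipode ℚ y) := by
  let b : WithConv (HPR D ⊗[ℚ] HPR D →ₗ[ℚ] ℚ) := toConv (TensorProduct.lift B)
  let b₁ : WithConv (HPR D ⊗[ℚ] HPR D →ₗ[ℚ] ℚ) :=
    toConv (TensorProduct.lift (B ∘ₗ HopfAlgebra.antipode ℚ))
  let b₂ : WithConv (HPR D ⊗[ℚ] HPR D →ₗ[ℚ] ℚ) :=
    toConv (TensorProduct.lift (B.compl₂ (HopfAlgebra.antipode ℚ)))
  have conv : ∀ (f g : HPR D →ₗ[ℚ] HPR D →ₗ[ℚ] ℚ) (x y : HPR D),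
      (toConv (TensorProduct.lift f) * toConv (TensorProduct.lift g)) (x ⊗ₜ[ℚ] y) =
        LinearMap.mul' ℚ ℚ (TensorProduct.map (TensorProduct.lift f) (TensorProduct.lift g)
          (TensorProduct.tensorTensorTensorComm ℚ _ _ _ _ (comulMap x ⊗ₜ comulMap y))) :=
    fun f g x y => rfl
  have one : ∀ x y : HPR D, (1 : WithConv (HPR D ⊗[ℚ] HPR D →ₗ[ℚ] ℚ)) (x ⊗ₜ[ℚ] y) =
      counitMap y * counitMap x := fun x y => rfl
  have h₁ : b₁ * b = 1 := by
    refine WithConv.ext (TensorProduct.ext' fun x y => ?_)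
    refine (conv _ _ x y).trans (.trans ?_ (one x y).symm)
    -- An arbitrary tensor `z` replaces `Δ(x)` to allow induction; axiom 2 gathers the two pairings
    -- into one, and the antipode identity then applies to its left argument.
    have e : ∀ z : HPR D ⊗[ℚ] HPR D, LinearMap.mul' ℚ ℚ (TensorProduct.map
        (TensorProduct.lift (B ∘ₗ HopfAlgebra.antipode ℚ)) (TensorProduct.lift B)
          (TensorProduct.tensorTensorTensorComm ℚ _ _ _ _ (z ⊗ₜ comulMap y))) =
        B (LinearMap.mul' ℚ _ ((HopfAlgebra.antipode ℚ).rTensor _ z)) y := by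
      intro z
      induction z with
      | zero => simp
      | add a b ha hb => simp only [TensorProduct.add_tmul, map_add, LinearMap.add_apply, ha, hb]
      | tmul a b =>
        rw [LinearMap.rTensor_tmul, LinearMap.mul'_apply, h.mul_left]
        change _ = B.tmul B _ (comulMap y)
        induction comulMap y with
        | zero => simp
        | add a b ha hb => simp only [TensorProduct.tmul_add, map_add, ha, hb]
        | tmul c d => simp [mul_comm]
    have hx : LinearMap.mul' ℚ _ ((HopfAlgebra.antipode ℚ).rTensor _ (comulMap x)) =
        algebraMap ℚ (HPR D) (counitMap x) := HopfAlgebra.mul_antipode_rTensor_comul_apply x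
    rw [e, hx, Algebra.algebraMap_eq_smul_one, map_smul, LinearMap.smul_apply, h.one_left,
      smul_eq_mul, mul_comm]
    rfl
  have h₂ : b * b₂ = 1 := by
    refine WithConv.ext (TensorProduct.ext' fun x y => ?_)
    refine (conv _ _ x y).trans (.trans ?_ (one x y).symm)
    have e : ∀ z : HPR D ⊗[ℚ] HPR D, LinearMap.mul' ℚ ℚ (TensorProduct.map
        (TensorProduct.lift B) (TensorProduct.lift (B.compl₂ (HopfAlgebra.antipode ℚ)))
          (TensorProduct.tensorTensorTensorComm ℚ _ _ _ _ (comulMap x ⊗ₜ z))) =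
        B x (LinearMap.mul' ℚ _ ((HopfAlgebra.antipode ℚ).lTensor _ z)) := by
      intro z
      induction z with
      | zero => simp
      | add a b ha hb => simp only [TensorProduct.tmul_add, map_add, ha, hb]
      | tmul a b =>
        rw [LinearMap.lTensor_tmul, LinearMap.mul'_apply, h.mul_right]
        induction comulMap x with
        | zero => simp
        | add a b ha hb =>
          simp only [TensorProduct.add_tmul, map_add, LinearMap.add_apply, ha, hb]
        | tmul c d => simp [mul_comm]
    have hy : LinearMap.mul' ℚ _ ((HopfAlgebra.antipode ℚ).lTensor _ (comulMap y)) =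
        algebraMap ℚ (HPR D) (counitMap y) := HopfAlgebra.mul_antipode_lTensor_comul_apply y
    rw [e, hy, Algebra.algebraMap_eq_smul_one, map_smul, h.one_right, smul_eq_mul]
  have := left_inv_eq_right_inv h₁ h₂
  exact congr(($this).ofConv (x ⊗ₜ y))

end IsPairing

-- Homogeneous elements, and finiteness of the forests with a given cut

theorem mono_mem_homogeneous (F : PForest D) : mono F ∈ homogeneous D (forestWeight F) :=
  Submodule.subset_span ⟨F, rfl, rfl⟩

theorem mul_mem_homogeneous {m n : ℕ} {x y : HPR D} (hx : x ∈ homogeneous D m)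
    (hy : y ∈ homogeneous D n) : x * y ∈ homogeneous D (m + n) := by
  induction hx using Submodule.span_induction with
  | zero => simp
  | add a b _ _ ha hb => rw [add_mul]; exact add_mem ha hb
  | smul r a _ ha => rw [smul_mul_assoc]; exact Submodule.smul_mem _ r ha
  | mem a ha =>
    obtain ⟨F, rfl, rfl⟩ := ha
    induction hy using Submodule.span_induction with
    | zero => simp
    | add a b _ _ ha hb => rw [mul_add]; exact add_mem ha hb
    | smul r a _ ha => rw [mul_smul_comm]; exact Submodule.smul_mem _ r ha
    | mem b hb =>
      obtain ⟨G, rfl, rfl⟩ := hb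
      rw [← mono_append, ← forestWeight_append]
      exact mono_mem_homogeneous _

theorem graft_mem_homogeneous {n : ℕ} {x : HPR D} (hx : x ∈ homogeneous D n) (d : D) :
    graft d x ∈ homogeneous D (n + 1) := by
  induction hx using Submodule.span_induction with
  | zero => simp
  | add a b _ _ ha hb => rw [map_add]; exact add_mem ha hb
  | smul r a _ ha => rw [map_smul]; exact Submodule.smul_mem _ r ha
  | mem a ha =>
    obtain ⟨F, rfl, rfl⟩ := ha
    rw [graft_mono]
    exact mono_mem_homogeneous [node d F]

/-- The forests that have an admissible cut `c` with `P^c = P` and `R^c = R`. -/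
def graftings (P R : PForest D) : Set (PForest D) :=
  {H | ∃ c ∈ cuts H, forestPruned c = P ∧ forestTrunk c = R}

/-- The first tree of `H` is either cut totally, and is then the first tree of `P`, or keeps its
root, which is then the root of the first tree of `R`; in that case an initial segment of `P` comes
from this tree and the rest from the other trees. -/
theorem graftings_subset (P R : PForest D) : graftings P R ⊆
    {[]} ∪ {H | ∃ t P', P = t :: P' ∧ ∃ H' ∈ graftings P' R, t :: H' = H} ∪
      {H | ∃ d R₀ R₁, R = node d R₀ :: R₁ ∧ ∃ i ∈ Finset.range (P.length + 1),
        ∃ A ∈ graftings (P.take i) R₀, ∃ A' ∈ graftings (P.drop i) R₁, node d A :: A' = H} := by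
  rintro H ⟨c, hc, rfl, rfl⟩
  cases H with
  | nil => simp
  | cons t H =>
    obtain ⟨d, F⟩ := t
    rw [cuts_cons, treeCuts_node] at hc
    simp only [List.mem_flatMap, List.mem_cons, List.mem_map] at hc
    obtain ⟨a, rfl | ⟨a, ha, rfl⟩, b, hb, rfl⟩ := hc
    · refine .inl (.inr ⟨node d F, forestPruned b, ?_, H, ⟨b, hb, rfl, ?_⟩, rfl⟩)
      · simp [forestPruned, pruned, unmark, forestUnmark_plain]
      · simp [forestTrunk, trunk]
    · refine .inr ⟨d, forestTrunk a, forestTrunk b, ?_, (forestPruned a).length, ?_, F,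
        ⟨a, ha, ?_, rfl⟩, H, ⟨b, hb, ?_, rfl⟩, rfl⟩ <;>
      simp [forestTrunk, trunk, forestPruned, pruned]

theorem finite_graftings (P R : PForest D) : (graftings P R).Finite := by
  generalize hn : forestWeight P + forestWeight R = n
  induction n using Nat.strong_induction_on generalizing P R with
  | _ n ih =>
    subst hn
    refine Set.Finite.subset ((Set.Finite.union (Set.finite_singleton []) ?_).union ?_)
      (graftings_subset P R)
    · rcases P with _ | ⟨⟨d, F⟩, P⟩
      · simp
      · have := ih _ (by simp only [forestWeight, weight]; omega) P R rfl
        refine (this.image (node d F :: ·)).subset ?_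
        rintro H ⟨t, P', e, H', h', rfl⟩
        obtain ⟨rfl, rfl⟩ := List.cons.inj e
        exact ⟨H', h', rfl⟩
    · rcases R with _ | ⟨⟨d, R₀⟩, R₁⟩
      · simp
      · have hw : ∀ i, forestWeight (P.take i) + forestWeight (P.drop i) = forestWeight P :=
          fun i => by rw [← forestWeight_append, List.take_append_drop]
        have h₀ : ∀ i, (graftings (P.take i) R₀).Finite := fun i =>
          ih _ (by have := hw i; simp only [forestWeight, weight]; omega) _ _ rfl
        have h₁ : ∀ i, (graftings (P.drop i) R₁).Finite := fun i =>
          ih _ (by have := hw i; simp only [forestWeight, weight]; omega) _ _ rfl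
        refine ((Finset.range (P.length + 1)).finite_toSet.biUnion fun i _ =>
          (h₀ i).image2 (fun A A' => node d A :: A') (h₁ i)).subset ?_
        rintro H ⟨d', R₀', R₁', e, i, hi, A, hA, A', hA', rfl⟩
        obtain ⟨e', rfl⟩ := List.cons.inj e
        obtain ⟨rfl, rfl⟩ := PTree.node.inj e'
        exact Set.mem_biUnion hi ⟨A, hA, A', hA', rfl⟩

-- Weights and finite support

namespace IsPairing

variable {B : LinearMap.BilinForm ℚ (HPR D)}

/-- Some term of the recursion is nonzero, so `γ_d` does not kill its pruned part, which must end
with the one-vertex tree `node d []`. -/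
theorem exists_cut_of_ne_zero (h : IsPairing B) {d : D} {F F' G : PForest D}
    (hne : B (mono (node d F :: F')) (mono G) ≠ 0) : ∃ P R, G ∈ graftings (P ++ [node d []]) R ∧
      B (mono F) (mono P) ≠ 0 ∧ B (mono F') (mono R) ≠ 0 := by
  classical
  rw [h.mono_cons_apply, comulMap_mono, map_list_sum, map_list_sum] at hne
  obtain ⟨z, hz, hz0⟩ := List.exists_mem_ne_zero_of_sum_ne_zero hne
  simp only [List.map_map, List.mem_map, Function.comp_apply, TensorProduct.map_tmul,
    LinearMap.mul'_apply, LinearMap.comp_apply] at hz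
  obtain ⟨c, hc, rfl⟩ := hz
  obtain ⟨h₁, h₂⟩ := mul_ne_zero_iff.1 hz0
  rcases List.eq_nil_or_concat (forestPruned c) with e | ⟨P, t, e⟩
  · simp [e, mono_nil, cutLast_one] at h₁
  · rw [List.concat_eq_append] at e
    rw [e, cutLast_mono_concat] at h₁
    by_cases ht : t = node d []
    · subst ht
      exact ⟨P, _, ⟨c, hc, e, rfl⟩, by simpa using h₁, h₂⟩
    · simp [ht] at h₁

theorem forestWeight_eq (h : IsPairing B) {F G : PForest D} (hne : B (mono F) (mono G) ≠ 0) :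
    forestWeight F = forestWeight G := by
  induction F using forest_induction generalizing G with
  | nil =>
    rw [mono_nil, h.one_left] at hne
    change counitMap (mono G) ≠ 0 at hne
    rw [counitMap_mono] at hne
    cases G <;> simp_all
  | cons d F F' hF hF' =>
    obtain ⟨P, R, ⟨c, hc, hP, rfl⟩, h₁, h₂⟩ := h.exists_cut_of_ne_zero hne
    rw [← weight_cut hc, hP, forestWeight_append, ← hF h₁, ← hF' h₂]
    rfl

theorem eq_zero_of_ne (h : IsPairing B) {m n : ℕ} {x y : HPR D} (hx : x ∈ homogeneous D m)
    (hy : y ∈ homogeneous D n) (hmn : m ≠ n) : B x y = 0 := by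
  induction hx using Submodule.span_induction with
  | zero => simp
  | add a b _ _ ha hb => rw [map_add, LinearMap.add_apply, ha, hb, add_zero]
  | smul r a _ ha => rw [map_smul, LinearMap.smul_apply, ha, smul_zero]
  | mem a ha =>
    obtain ⟨F, rfl, rfl⟩ := ha
    induction hy using Submodule.span_induction with
    | zero => simp
    | add a b _ _ ha hb => rw [map_add, ha, hb, add_zero]
    | smul r a _ ha => rw [map_smul, ha, smul_zero]
    | mem b hb =>
      obtain ⟨G, rfl, rfl⟩ := hb
      by_contra hne
      exact hmn (h.forestWeight_eq hne)

/-- A forest `G` pairing nontrivially with `B_d^+(F) F'` is a grafting of `P • _d` and `R`, where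
`P` and `R` range over the finite supports of `F` and `F'`; `finite_graftings` leaves finitely many
`G`, even for infinite `D`. -/
theorem finite_support (h : IsPairing B) (x : HPR D) : {G | B x (mono G) ≠ 0}.Finite := by
  have hx := (forestBasis D).mem_span x
  induction hx using Submodule.span_induction with
  | zero => simp
  | add x y _ _ hx hy =>
    refine (hx.union hy).subset fun G hG => ?_
    by_contra hc
    simp only [Set.mem_union, Set.mem_ofPred_eq, not_or, not_not] at hc hG
    simp [hc.1, hc.2] at hG
  | smul r x _ hx =>
    refine hx.subset fun G hG => ?_
    simp only [Set.mem_ofPred_eq, map_smul, LinearMap.smul_apply] at hG ⊢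
    exact right_ne_zero_of_smul hG
  | mem x hx =>
    obtain ⟨F, rfl⟩ := hx
    rw [forestBasis_apply]
    induction F using forest_induction with
    | nil =>
      refine (Set.finite_singleton []).subset fun G hG => ?_
      have := h.forestWeight_eq hG
      exact eq_nil_of_forestWeight this.symm
    | cons d F F' hF hF' =>
      refine (hF.biUnion fun P _ => hF'.biUnion fun R _ =>
        finite_graftings (P ++ [node d []]) R).subset fun G hG => ?_
      obtain ⟨P, R, hG, h₁, h₂⟩ := h.exists_cut_of_ne_zero hG
      exact Set.mem_biUnion h₁ (Set.mem_biUnion h₂ hG)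

end IsPairing

-- Triangularity and construction of the dual elements

open Classical in
theorem coord_mono (F G : PForest D) :
    (forestBasis D).coord F (mono G) = if F = G then 1 else 0 := by
  rw [← forestBasis_apply, Module.Basis.coord_apply, Module.Basis.repr_self,
    Finsupp.single_apply]
  simp [eq_comm]

-- If `G = A K` with `K` at least as heavy as `G`, then `A` is empty.
open Classical in
theorem coord_mul_mono {G K : PForest D} (hK : forestWeight G ≤ forestWeight K) (x : HPR D) :
    (forestBasis D).coord G (x * mono K) = if K = G then counitMap x else 0 := by
  have : (forestBasis D).coord G ∘ₗ LinearMap.mulRight ℚ (mono K) =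
      if K = G then counitMap else 0 := by
    refine (forestBasis D).ext fun A => ?_
    have hA : G = A ++ K ↔ K = G ∧ A = [] := by
      constructor
      · rintro rfl
        rw [forestWeight_append] at hK
        have := eq_nil_of_forestWeight (F := A) (by omega)
        simp [this]
      · rintro ⟨rfl, rfl⟩; rfl
    rw [forestBasis_apply, LinearMap.comp_apply, LinearMap.mulRight_apply, ← mono_append,
      coord_mono]
    simp only [hA]
    by_cases hKG : K = G
    · simp [hKG, counitMap_mono]
    · simp [hKG]
  rw [← LinearMap.mulRight_apply (R := ℚ), ← LinearMap.comp_apply, this]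
  split_ifs <;> rfl

open Classical in
/-- The value of `G^* * (T^* ∘ γ_d)`, where `F^*` is the coordinate along `F`, on the forests whose
last tree has a weight of at least `|G| + 1`. -/
theorem coord_mul_coord_cutLast (T G H K : PForest D) (d d' : D)
    (hK : forestWeight G ≤ forestWeight K) :
    LinearMap.mul' ℚ ℚ (TensorProduct.map ((forestBasis D).coord G)
      ((forestBasis D).coord T ∘ₗ cutLast d) (comulMap (mono (H ++ [node d' K])))) =
      if T ++ [node d G] = H ++ [node d' K] then 1 else 0 := by
  -- The part `t ⊗ 1` of `Δ(t)`, with `t = node d' K`, contributes nothing: `t` is heavier than `G`.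
  have h₁ : ∀ z : HPR D ⊗[ℚ] HPR D, LinearMap.mul' ℚ ℚ (TensorProduct.map
      ((forestBasis D).coord G) ((forestBasis D).coord T ∘ₗ cutLast d)
        (z * (mono [node d' K] ⊗ₜ 1))) = 0 := by
    intro z
    induction z with
    | zero => simp
    | add a b ha hb => rw [add_mul, map_add, map_add, ha, hb, add_zero]
    | tmul a b =>
      have hne : [node d' K] ≠ G := by
        rintro rfl
        simp only [forestWeight, weight] at hK
        omega
      rw [Algebra.TensorProduct.tmul_mul_tmul, TensorProduct.map_tmul, LinearMap.mul'_apply,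
        coord_mul_mono (by simp only [forestWeight, weight]; omega), if_neg hne, zero_mul]
  -- In the other part the right factor ends with a grafted tree, which `γ_d` kills unless it is a
  -- single vertex decorated by `d`. With `w = Δ(K)`, only the term `K ⊗ 1` survives.
  have h₂ : ∀ z w : HPR D ⊗[ℚ] HPR D, LinearMap.mul' ℚ ℚ (TensorProduct.map
      ((forestBasis D).coord G) ((forestBasis D).coord T ∘ₗ cutLast d)
        (z * (graft d').lTensor _ w)) = if d' = d then LinearMap.mul' ℚ ℚ (TensorProduct.map
          ((forestBasis D).coord G) ((forestBasis D).coord T)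
            (z * (TensorProduct.rid ℚ _ (counitMap.lTensor _ w) ⊗ₜ 1))) else 0 := by
    intro z w
    induction w with
    | zero => simp
    | add a b ha hb =>
      simp only [map_add, mul_add, ha, hb, TensorProduct.add_tmul]
      split_ifs <;> simp
    | tmul u v =>
      induction z with
      | zero => simp
      | add a b ha hb =>
        simp only [map_add, add_mul, ha, hb]
        split_ifs <;> simp
      | tmul a b =>
        simp only [LinearMap.lTensor_tmul, Algebra.TensorProduct.tmul_mul_tmul,
          TensorProduct.map_tmul, LinearMap.mul'_apply, LinearMap.comp_apply, cutLast_mul,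
          cutLast_graft, counitMap_graft, TensorProduct.rid_tmul]
        split_ifs <;> simp; ring
  -- Since `K` is at least as heavy as `G`, the left factor must be exactly `K = G`; with `z =
  -- Δ(H)`, the counit on the left then leaves `H`.
  have h₃ : ∀ z : HPR D ⊗[ℚ] HPR D, LinearMap.mul' ℚ ℚ (TensorProduct.map
      ((forestBasis D).coord G) ((forestBasis D).coord T) (z * (mono K ⊗ₜ 1))) =
      if K = G then (forestBasis D).coord T (TensorProduct.lid ℚ _ (counitMap.rTensor _ z))
        else 0 := by
    intro z
    induction z with
    | zero => simp
    | add a b ha hb =>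
      simp only [map_add, add_mul, ha, hb]
      split_ifs <;> simp
    | tmul a b =>
      rw [Algebra.TensorProduct.tmul_mul_tmul, TensorProduct.map_tmul, LinearMap.mul'_apply,
        coord_mul_mono hK]
      split_ifs <;> simp
  have hl : counitMap.lTensor _ (comulMap (mono K)) = mono K ⊗ₜ 1 :=
    Coalgebra.lTensor_counit_comul (R := ℚ) (mono K)
  have hr : counitMap.rTensor _ (comulMap (mono H)) = 1 ⊗ₜ mono H :=
    Coalgebra.rTensor_counit_comul (R := ℚ) (mono H)
  rw [comulMap_mono_append, ← graft_mono, comulMap_graft, mul_add, map_add, map_add, graft_mono,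
    h₁, h₂, hl, TensorProduct.rid_tmul, one_smul, h₃, hr, TensorProduct.lid_tmul, one_smul,
    coord_mono, zero_add]
  have he : T ++ [node d G] = H ++ [node d' K] ↔ d' = d ∧ K = G ∧ T = H := by
    constructor
    · intro e
      obtain ⟨rfl, e⟩ := List.append_inj' e rfl
      simp_all
    · rintro ⟨rfl, rfl, rfl⟩; rfl
  simp only [he, ite_and]

namespace IsPairing

variable {B : LinearMap.BilinForm ℚ (HPR D)}

theorem mul_graft_apply_concat (h : IsPairing B) (T G : PForest D) (d : D) {u v : HPR D}
    (hu : B u = (forestBasis D).coord G) (hv : B v = (forestBasis D).coord T) (H K : PForest D)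
    (d' : D) (hK : forestWeight G ≤ forestWeight K) :
    B (u * graft d v) (mono (H ++ [node d' K])) =
      (forestBasis D).coord (T ++ [node d G]) (mono (H ++ [node d' K])) := by
  classical
  have : B (graft d v) = B v ∘ₗ cutLast d := LinearMap.ext fun z => h.graft_left _ z d
  rw [h.mul_left, tmul_apply_tmul_left, this, hu, hv]
  exact (coord_mul_coord_cutLast T G H K d d' hK).trans (coord_mono _ _).symm

/-- Outer induction on the weight of `F = T B_d^+(G)` provides `u` and `v` dual to `G` and `T`;
inner induction on the weight of `G` removes the error of `u B_d^+(v)`. -/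
theorem exists_eq_coord (h : IsPairing B) (F : PForest D) :
    ∃ y ∈ homogeneous D (forestWeight F), B y = (forestBasis D).coord F := by
  classical
  generalize hn : forestWeight F = n
  induction n using Nat.strong_induction_on generalizing F with
  | _ n ih =>
    rcases List.eq_nil_or_concat F with rfl | ⟨T, t, rfl⟩
    · refine ⟨1, hn ▸ mono_mem_homogeneous [], (forestBasis D).ext fun G => ?_⟩
      rw [h.one_left, forestBasis_apply, coord_mono]
      exact (counitMap_mono G).trans (by cases G <;> simp)
    · obtain ⟨d, G⟩ := t
      rw [List.concat_eq_append] at hn ⊢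
      generalize hm : forestWeight G = m
      induction m using Nat.strong_induction_on generalizing T d G with
      | _ m ih' =>
        have hw : forestWeight T + forestWeight G + 1 = n := by
          rw [← hn, forestWeight_append]; simp [forestWeight, weight, add_assoc]
        obtain ⟨u, hu, hu'⟩ := ih _ (by omega) G rfl
        obtain ⟨v, hv, hv'⟩ := ih _ (by omega) T rfl
        have hy : u * graft d v ∈ homogeneous D n := by
          have := mul_mem_homogeneous hu (graft_mem_homogeneous hv d)
          rwa [show forestWeight G + (forestWeight T + 1) = n by omega] at this
        set y := u * graft d v with hydef
        -- The error terms: the forests other than `F` on which `y` has a nonzero pairing.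
        set s := (h.finite_support y).toFinset.erase (T ++ [node d G]) with hs
        have hd : ∀ H ∈ s, ∃ z ∈ homogeneous D n, B z = (forestBasis D).coord H := by
          intro H hH
          rw [hs, Finset.mem_erase, Set.Finite.mem_toFinset, Set.mem_ofPred_eq] at hH
          obtain ⟨hne, hH⟩ := hH
          have hHn : forestWeight H = n := by
            by_contra hc
            exact hH (h.eq_zero_of_ne hy (mono_mem_homogeneous H) (Ne.symm hc))
          rcases List.eq_nil_or_concat H with rfl | ⟨H, ⟨d', K⟩, rfl⟩
          · simp only [forestWeight] at hHn; omega
          · rw [List.concat_eq_append] at *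
            refine ih' (forestWeight K) ?_ H d' K hHn rfl
            -- If `K` were at least as heavy as `G`, triangularity would make the pairing of `y`
            -- with this forest zero.
            by_contra hc
            rw [hydef, h.mul_graft_apply_concat T G d hu' hv' H K d' (by omega), coord_mono,
              if_neg hne.symm] at hH
            exact hH rfl
        choose! z hz hz' using hd
        refine ⟨y - ∑ H ∈ s, B y (mono H) • z H,
          sub_mem hy (sum_mem fun H hH => Submodule.smul_mem _ _ (hz H hH)),
          (forestBasis D).ext fun A => ?_⟩
        have hsum : (∑ H ∈ s, B (B y (mono H) • z H)) (mono A) =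
            if A ∈ s then B y (mono A) else 0 := by
          rw [LinearMap.sum_apply, Finset.sum_congr rfl fun H hH => by
            rw [map_smul, hz' H hH, LinearMap.smul_apply, coord_mono]]
          simp
        rw [forestBasis_apply, map_sub, map_sum, LinearMap.sub_apply, hsum, coord_mono]
        by_cases hA : T ++ [node d G] = A
        · subst hA
          rw [if_neg (by simp [hs]), if_pos rfl, hydef,
            h.mul_graft_apply_concat T G d hu' hv' T G d le_rfl, coord_mono, if_pos rfl, sub_zero]
        · rw [if_neg hA]
          split_ifs with hAs
          · exact sub_self _
          · rw [hs, Finset.mem_erase, Set.Finite.mem_toFinset, Set.mem_ofPred_eq, not_and,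
              not_not] at hAs
            rw [hAs (Ne.symm hA), sub_zero]

-- Non-degeneracy, the dual basis and its coproduct

/-- Every coordinate form on forests is `(z, ·)` for some `z`. -/
theorem ext_right (h : IsPairing B) {x y : HPR D} (hxy : ∀ z, B z x = B z y) : x = y := by
  refine (forestBasis D).ext_elem fun F => ?_
  obtain ⟨z, -, hz⟩ := h.exists_eq_coord F
  simpa [hz] using hxy z

theorem ext_left (h : IsPairing B) {x y : HPR D} (hxy : B x = B y) : x = y :=
  h.ext_right fun z => by rw [h.symm, hxy, h.symm]

theorem nondegenerate (h : IsPairing B) : B.Nondegenerate :=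
  ⟨fun x hx => h.ext_left (LinearMap.ext fun y => by simpa using hx y),
    fun y hy => h.ext_right fun z => by simpa using hy z⟩

/-- The basis dual to the basis of forests. -/
noncomputable def dualBasis (h : IsPairing B) : Module.Basis (PForest D) ℚ (HPR D) :=
  let e : PForest D → HPR D := fun F => (h.exists_eq_coord F).choose
  have he : ∀ F, B (e F) = (forestBasis D).coord F := fun F =>
    (h.exists_eq_coord F).choose_spec.2
  Module.Basis.mk (v := e)
    (by
      refine LinearIndependent.of_comp B ?_
      have : B ∘ e = (forestBasis D).coord := funext he
      rw [this]
      exact (forestBasis D).linearIndependent_coord)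
    (by
      classical
      intro x _
      -- The expansion is a finite sum by `finite_support`; both sides have the same pairing with
      -- every forest.
      have hx : x = ∑ G ∈ (h.finite_support x).toFinset, B x (mono G) • e G := by
        refine h.ext_left ((forestBasis D).ext fun A => ?_)
        rw [map_sum, LinearMap.sum_apply]
        simp only [map_smul, he, LinearMap.smul_apply, forestBasis_apply, coord_mono]
        simp
      rw [hx]
      exact sum_mem fun G _ => Submodule.smul_mem _ _ (Submodule.subset_span ⟨G, rfl⟩))

theorem apply_dualBasis (h : IsPairing B) (F : PForest D) :
    B (h.dualBasis F) = (forestBasis D).coord F := by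
  rw [dualBasis, Module.Basis.mk_apply]
  exact (h.exists_eq_coord F).choose_spec.2

theorem dualBasis_mem_homogeneous (h : IsPairing B) (F : PForest D) :
    h.dualBasis F ∈ homogeneous D (forestWeight F) := by
  rw [dualBasis, Module.Basis.mk_apply]
  exact (h.exists_eq_coord F).choose_spec.1

theorem isDualFamily_iff (h : IsPairing B) (e : PForest D → HPR D) :
    IsDualFamily B e ↔ e = h.dualBasis := by
  have key : ∀ F, B (h.dualBasis F) = (forestBasis D).coord F := h.apply_dualBasis
  constructor
  · intro he
    refine funext fun F => h.ext_left ((forestBasis D).ext fun G => ?_)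
    rw [key, forestBasis_apply, he F G, coord_mono]
  · rintro rfl F G
    rw [key, coord_mono]

theorem dualBasis_coord (h : IsPairing B) (F : PForest D) (x : HPR D) :
    h.dualBasis.repr x F = B x (mono F) := by
  classical
  have : h.dualBasis.coord F = LinearMap.flip B (mono F) := by
    refine h.dualBasis.ext fun G => ?_
    rw [LinearMap.flip_apply, h.apply_dualBasis, coord_mono, Module.Basis.coord_apply,
      Module.Basis.repr_self, Finsupp.single_apply]
  exact LinearMap.congr_fun this x

/-- The pairings with `mono F ⊗ mono G` are the coordinates in the tensor square of the dual basis.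
-/
theorem tmul_ext (h : IsPairing B) {z w : HPR D ⊗[ℚ] HPR D}
    (hzw : ∀ F G, B.tmul B z (mono F ⊗ₜ mono G) = B.tmul B w (mono F ⊗ₜ mono G)) : z = w := by
  have key : ∀ F G (z : HPR D ⊗[ℚ] HPR D), (h.dualBasis.tensorProduct h.dualBasis).repr z (F, G) =
      B.tmul B z (mono F ⊗ₜ mono G) := by
    intro F G z
    induction z with
    | zero => simp
    | add a b ha hb => simp [ha, hb]
    | tmul a b => simp [h.dualBasis_coord, mul_comm]
  refine (h.dualBasis.tensorProduct h.dualBasis).ext_elem fun ⟨F, G⟩ => ?_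
  rw [key, key, hzw]

/-- By adjunction, pairing the left side with `G ⊗ G'` gives `(e_F, G G')`, which is `1` exactly
when `F = G G'`; on the right only the cut at `i = G.length` can then contribute. -/
theorem comul_dualBasis (h : IsPairing B) (F : PForest D) :
    Coalgebra.comul (R := ℚ) (h.dualBasis F) = ∑ i ∈ Finset.range (F.length + 1),
      h.dualBasis (F.take i) ⊗ₜ[ℚ] h.dualBasis (F.drop i) := by
  classical
  refine h.tmul_ext fun G G' => ?_
  refine (h.mul_right _ _ _).symm.trans ?_
  rw [← mono_append, h.apply_dualBasis, coord_mono, map_sum, LinearMap.sum_apply]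
  simp only [LinearMap.BilinForm.tensorDistrib_tmul, h.apply_dualBasis, coord_mono, smul_eq_mul,
    ← ite_and, mul_ite, mul_one, mul_zero]
  by_cases hF : F = G ++ G'
  · subst hF
    rw [if_pos rfl, Finset.sum_eq_single G.length]
    · simp
    · intro i hi hne
      rw [Finset.mem_range, List.length_append] at hi
      refine if_neg fun hc => hne ?_
      have := congr_arg List.length hc.1
      rw [List.length_take, List.length_append] at this
      omega
    · intro hc
      simp at hc
  · rw [if_neg hF]
    refine (Finset.sum_eq_zero fun i _ => if_neg fun hc => hF ?_).symm
    rw [← hc.1, ← hc.2, List.take_append_drop]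

-- Primitive elements

theorem dualBasis_nil (h : IsPairing B) : h.dualBasis [] = 1 := by
  refine h.ext_left ((forestBasis D).ext fun G => ?_)
  rw [h.apply_dualBasis, h.one_left, forestBasis_apply, coord_mono]
  exact .trans (by cases G <;> simp) (counitMap_mono G).symm

theorem dualBasis_singleton_mem (h : IsPairing B) (t : PTree D) :
    h.dualBasis [t] ∈ primitives D := by
  change Coalgebra.comul (R := ℚ) _ = _
  rw [h.comul_dualBasis]
  simp [Finset.sum_range_succ, h.dualBasis_nil, add_comm]

theorem apply_primitive (h : IsPairing B) {x : HPR D} (hx : x ∈ primitives D) (y₁ y₂ : HPR D) :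
    B x (y₁ * y₂) = B x y₁ * counitMap y₂ + counitMap y₁ * B x y₂ := by
  have hx' : comulMap x = x ⊗ₜ 1 + 1 ⊗ₜ x := hx
  rw [h.mul_right, hx', map_add, LinearMap.add_apply, LinearMap.BilinForm.tensorDistrib_tmul,
    LinearMap.BilinForm.tensorDistrib_tmul, h.one_left, h.one_left, smul_eq_mul, smul_eq_mul,
    mul_comm, mul_comm (B x y₂)]
  rfl

/-- The coordinates of `x` in the dual basis are its pairings with forests. For primitive `x` they
vanish on products of two nonempty forests, whose counits are zero, and on the empty forest, since
`(x, 1) = 2 (x, 1)`. -/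
theorem primitive_mem_span (h : IsPairing B) {x : HPR D} (hx : x ∈ primitives D) :
    x ∈ Submodule.span ℚ (Set.range fun t : PTree D => h.dualBasis [t]) := by
  rw [← h.dualBasis.linearCombination_repr x, Finsupp.linearCombination_apply]
  refine sum_mem fun F hF => Submodule.smul_mem _ _ ?_
  rw [Finsupp.mem_support_iff, h.dualBasis_coord] at hF
  match F, hF with
  | [], hF =>
    have := h.apply_primitive hx 1 1
    rw [mul_one, counitMap_one] at this
    exact absurd (by rw [mono_nil]; linarith) hF
  | [t], _ => exact Submodule.subset_span ⟨t, rfl⟩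
  | t :: t' :: F, hF =>
    rw [mono_cons, ← mono_singleton, h.apply_primitive hx, counitMap_mono, counitMap_mono] at hF
    simp at hF

/-- The basis of the primitive elements formed by the dual elements of the trees. -/
noncomputable def primitiveBasis (h : IsPairing B) :
    Module.Basis (PTree D) ℚ (primitives D) :=
  Module.Basis.mk (v := fun t => ⟨h.dualBasis [t], h.dualBasis_singleton_mem t⟩)
    (by
      refine LinearIndependent.of_comp (primitives D).subtype ?_
      exact h.dualBasis.linearIndependent.comp (fun t : PTree D => [t])
        fun _ _ e => List.singleton_injective e)
    (by
      rintro ⟨x, hx⟩ -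
      have : x ∈ (Submodule.span ℚ (Set.range fun t : PTree D =>
          (⟨h.dualBasis [t], h.dualBasis_singleton_mem t⟩ : primitives D))).map
            (primitives D).subtype := by
        rw [Submodule.map_span, ← Set.range_comp]
        exact h.primitive_mem_span hx
      obtain ⟨y, hy, rfl⟩ := this
      exact hy)

end IsPairing

end HPR

theorem mainTheorem4 (D : Type*) :
    (∃! B : LinearMap.BilinForm ℚ (HPR D), HPR.IsPairing B) ∧
    ∀ B : LinearMap.BilinForm ℚ (HPR D), HPR.IsPairing B →
      (∀ (m n : ℕ) (x y : HPR D), x ∈ HPR.homogeneous D m → y ∈ HPR.homogeneous D n → m ≠ n →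
        B x y = 0) ∧
      B.IsSymm ∧
      B.Nondegenerate ∧
      (∀ x y : HPR D, B (HopfAlgebra.antipode ℚ x) y = B x (HopfAlgebra.antipode ℚ y)) ∧
      ∃ e : Module.Basis (PForest D) ℚ (HPR D),
        (∀ e' : PForest D → HPR D, HPR.IsDualFamily B e' ↔ e' = e) ∧
        (∀ F : PForest D, e F ∈ HPR.homogeneous D (PTree.forestWeight F)) ∧
        (∃ b : Module.Basis (PTree D) ℚ (HPR.primitives D), ∀ t : PTree D, (b t : HPR D) = e [t]) ∧
        ∀ F : PForest D, Coalgebra.comul (R := ℚ) (e F) =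
          ∑ i ∈ Finset.range (F.length + 1), e (F.take i) ⊗ₜ[ℚ] e (F.drop i) := by
  refine ⟨⟨HPR.pairing D, HPR.isPairing_pairing, fun B h => h.eq HPR.isPairing_pairing⟩,
    fun B h => ⟨fun m n x y hx hy hmn => h.eq_zero_of_ne hx hy hmn, ⟨h.symm⟩, h.nondegenerate,
      h.antipode_left, h.dualBasis, h.isDualFamily_iff, h.dualBasis_mem_homogeneous,
      ⟨h.primitiveBasis, fun t => ?_⟩, h.comul_dualBasis⟩⟩
  rw [HPR.IsPairing.primitiveBasis, Module.Basis.mk_apply]
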